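/- Let $\iota\colon A\to X$ be a continuous map of topological spaces, and write $\simeq$ for homotopy of maps. Let $g_0=\iota\colon G_0=A\to X$. For $i\ge 0$, let $F_i$ be the homotopy pullback of $g_i\colon G_i\to X\leftarrow A:\iota$, that is, the space of triples $(e,\omega,a)\in G_i\times X^{[0,1]}\times A$ with $\omega(0)=g_i(e)$ and $\omega(1)=\iota(a)$, let $G_{i+1}$ be the homotopy pushout (double mapping cylinder) of the two projections $G_i\leftarrow F_i\to A$, let $\gamma_i\colon G_i\to G_{i+1}$ be the canonical inclusion, and let $g_{i+1}\colon G_{i+1}\to X$ be the map that is $g_i$ on $G_i$, $\iota$ on $A$, and sends $((e,\omega,a),t)$ to $\omega(t)$. For $k\le i$ let $\gamma_{k,i}=\gamma_{i-1}\circ\dots\circ\gamma_k\colon G_k\to G_i$, with $\gamma_{k,k}=\mathrm{id}$. A homotopy section of $g_n$ is a map $\sigma\colon X\to G_n$ with $g_n\circ\sigma\simeq\mathrm{id}_X$; for $k\le n$ it is called compatible with $g_k$ if $\sigma\circ g_k\simeq\gamma_{k,n}$. The relative category of order $k$, $\mathrm{relcat}_k\,\iota\in\mathbb N\cup\{\infty\}$,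 is the least integer $n\ge k$ such that $g_n$ has a homotopy section compatible with $g_k$, and $\infty$ if there is no such $n$. Theorem. For every map $\iota\colon A\to X$ and every integer $k\ge 0$, $$\mathrm{relcat}_k\,\iota\;\le\;\mathrm{relcat}_{k+1}\,\iota\;\le\;\mathrm{relcat}_k\,\iota+1 .$$ Moreover, for every $n\ge k$, if $\sigma$ is a homotopy section of $g_n$ that is compatible with $g_k$, then $\gamma_n\circ\sigma$ is a homotopy section of $g_{n+1}$ that is compatible with $g_{k+1}$. -/

import Mathlib

universe u

namespace Ganea

section HomotopySquares

variable {A E F X : Type u}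
  [TopologicalSpace A] [TopologicalSpace E] [TopologicalSpace F] [TopologicalSpace X]

/-- The standard homotopy pullback of `f : E → X ← A : g`: triples `(e, ω, a)` where `ω` is a path
in `X` from `f e` to `g a`. The path space carries the compact-open topology. -/
def HPullback (f : C(E, X)) (g : C(A, X)) : Type u :=
  {p : E × C(unitInterval, X) × A // p.2.1 0 = f p.1 ∧ p.2.1 1 = g p.2.2}

instance (f : C(E, X)) (g : C(A, X)) : TopologicalSpace (HPullback f g) :=
  inferInstanceAs (TopologicalSpace {p : E × C(unitInterval, X) × A //
    p.2.1 0 = f p.1 ∧ p.2.1 1 = g p.2.2})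

/-- The projection of the homotopy pullback to the source of the first map. -/
def HPullback.fst (f : C(E, X)) (g : C(A, X)) : C(HPullback f g, E) where
  toFun p := p.1.1
  continuous_toFun := continuous_fst.comp continuous_subtype_val

/-- The projection of the homotopy pullback to the source of the second map. -/
def HPullback.snd (f : C(E, X)) (g : C(A, X)) : C(HPullback f g, A) where
  toFun p := p.1.2.2
  continuous_toFun := (continuous_snd.comp continuous_snd).comp continuous_subtype_val

/-- The canonical homotopy which makes the homotopy pullback square commute up to homotopy:
at time `t` it sends `(e, ω, a)` to `ω t`. -/
def HPullback.homotopy (f : C(E, X)) (g : C(A, X)) :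
    (f.comp (HPullback.fst f g)).Homotopy (g.comp (HPullback.snd f g)) where
  toFun q := q.2.1.2.1 q.1
  continuous_toFun := by
    have h : Continuous fun q : unitInterval × HPullback f g => q.2.1.2.1 :=
      (continuous_fst.comp continuous_snd).comp (continuous_subtype_val.comp continuous_snd)
    exact ContinuousEval.continuous_eval.comp (h.prodMk continuous_fst)
  map_zero_left p := p.2.1
  map_one_left p := p.2.2

/-- The gluing relation of the double mapping cylinder of `b : F → E` and `h : F → A`:
`(z, 0)` is glued to `b z` and `(z, 1)` to `h z`. -/
inductive HPushout.Rel (b : C(F, E)) (h : C(F, A)) :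
    E ⊕ (F × unitInterval) ⊕ A → E ⊕ (F × unitInterval) ⊕ A → Prop
  | zero (z : F) : HPushout.Rel b h (Sum.inr (Sum.inl (z, 0))) (Sum.inl (b z))
  | one (z : F) : HPushout.Rel b h (Sum.inr (Sum.inl (z, 1))) (Sum.inr (Sum.inr (h z)))

/-- The standard homotopy pushout of `E ← F → A`: the double mapping cylinder
`(E ⊔ F × [0,1] ⊔ A) / ((z, 0) ∼ b z, (z, 1) ∼ h z)`, with the quotient topology. -/
def HPushout (b : C(F, E)) (h : C(F, A)) : Type u :=
  Quot (HPushout.Rel b h)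

instance (b : C(F, E)) (h : C(F, A)) : TopologicalSpace (HPushout b h) :=
  inferInstanceAs (TopologicalSpace (Quot (HPushout.Rel b h)))

/-- The inclusion of the first end of the double mapping cylinder. -/
def HPushout.inl (b : C(F, E)) (h : C(F, A)) : C(E, HPushout b h) where
  toFun e := Quot.mk _ (Sum.inl e)
  continuous_toFun := continuous_quot_mk.comp continuous_inl

/-- The inclusion of the second end of the double mapping cylinder. -/
def HPushout.inr (b : C(F, E)) (h : C(F, A)) : C(A, HPushout b h) where
  toFun a := Quot.mk _ (Sum.inr (Sum.inr a))
  continuous_toFun := continuous_quot_mk.comp (continuous_inr.comp continuous_inr)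

/-- The whisker map `(f, g)` out of a homotopy pushout that is induced by `f : E → X`, `g : A → X`
and a homotopy `H` from `f ∘ b` to `g ∘ h`: it is `f` on `E`, `g` on `A`, and sends `(z, t)` to
`H (t, z)`. -/
def HPushout.whisker (b : C(F, E)) (h : C(F, A)) (f : C(E, X)) (g : C(A, X))
    (H : (f.comp b).Homotopy (g.comp h)) : C(HPushout b h, X) where
  toFun := Quot.lift (Sum.elim f (Sum.elim (fun q => H (q.2, q.1)) g)) (by
    intro x y hxy
    cases hxy with
    | zero z => simp
    | one z => simp)
  continuous_toFun := by
    refine continuous_quot_lift _ ?_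
    have hH : Continuous fun q : F × unitInterval => H (q.2, q.1) :=
      H.continuous.comp (continuous_snd.prodMk continuous_fst)
    exact f.continuous.sumElim (hH.sumElim g.continuous)

end HomotopySquares

section GaneaConstruction

/-- A topological space together with a continuous map to `X`. -/
structure SpaceOver (X : Type u) [TopologicalSpace X] where
  carrier : Type u
  [top : TopologicalSpace carrier]
  map : C(carrier, X)

attribute [instance] SpaceOver.top

variable {A X : Type u} [TopologicalSpace A] [TopologicalSpace X]

/-- The join over `X` of `g : E → X` and `ι : A → X`: the homotopy pushout of the two projections
of the homotopy pullback of `g` and `ι`, with its whisker map `(g, ι)` to `X`. -/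
def SpaceOver.join (E : SpaceOver X) (ι : C(A, X)) : SpaceOver X where
  carrier := HPushout (HPullback.fst E.map ι) (HPullback.snd E.map ι)
  map := HPushout.whisker _ _ E.map ι (HPullback.homotopy E.map ι)

/-- The Ganea construction of `ι : A → X`: it starts with `ι` itself, and the stage `i + 1` is the
join over `X` of the stage `i` and `ι`. -/
def construction (ι : C(A, X)) : ℕ → SpaceOver X
  | 0 => ⟨A, ι⟩
  | i + 1 => (construction ι i).join ι

/-- The space `G_i(ι)`. -/
abbrev G (ι : C(A, X)) (i : ℕ) : Type u := (construction ι i).carrier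

/-- The Ganea map `g_i(ι) : G_i(ι) → X`. -/
abbrev g (ι : C(A, X)) (i : ℕ) : C(G ι i, X) := (construction ι i).map

/-- The map `γ_i : G_i(ι) → G_{i+1}(ι)` of the Ganea construction. -/
def γ (ι : C(A, X)) (i : ℕ) : C(G ι i, G ι (i + 1)) :=
  HPushout.inl (HPullback.fst (g ι i) ι) (HPullback.snd (g ι i) ι)

/-- The map `γ_{k,i} = γ_{i-1} ∘ ⋯ ∘ γ_k : G_k(ι) → G_i(ι)` for `k ≤ i`; it is the identity when
`i = k`. -/
def γTo (ι : C(A, X)) (k : ℕ) {i : ℕ} (hki : k ≤ i) : C(G ι k, G ι i) :=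
  Nat.leRec (motive := fun i _ => C(G ι k, G ι i))
    (ContinuousMap.id _) (fun i _ f => (γ ι i).comp f) hki

/-- `σ` is a homotopy section of `g_n(ι)`. -/
def IsHomotopySection (ι : C(A, X)) (n : ℕ) (σ : C(X, G ι n)) : Prop :=
  ((g ι n).comp σ).Homotopic (ContinuousMap.id X)

/-- The map `σ : X → G_n(ι)`, where `k ≤ n`, is compatible with `g_k(ι)`:
`σ ∘ g_k ≃ γ_{k,n}`. -/
def IsCompatible (ι : C(A, X)) {k n : ℕ} (hkn : k ≤ n) (σ : C(X, G ι n)) : Prop :=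
  (σ.comp (g ι k)).Homotopic (γTo ι k hkn)

/-- The relative category of order `k` of `ι`: the least `n ≥ k` such that `g_n` has a homotopy
section which is compatible with `g_k`; it is `⊤` if there is no such `n`. -/
noncomputable def relcat (k : ℕ) (ι : C(A, X)) : ℕ∞ :=
  sInf {m : ℕ∞ | ∃ n : ℕ, m = n ∧ ∃ (hkn : k ≤ n) (σ : C(X, G ι n)),
    IsHomotopySection ι n σ ∧ IsCompatible ι hkn σ}

end GaneaConstruction

end Ganea

/-! The lower bound is restriction: precomposing $\sigma\circ g_{k+1}\simeq\gamma_{k+1,n}$ with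
$\gamma_k$ gives compatibility with $g_k$. The upper bound is the second claim. Replace $g_n$ by its
path fibration, so that $\sigma$ lifts to a strict section $t$. Maps over $X$ into the fibration can
be joined with $\iota$ (`Join.map`), and vertically homotopic maps have homotopic joins. Three facts
then give $\gamma_n\sigma g_{k+1}\simeq\gamma_{k+1,n+1}$. (1) A map over $X$ defined on all of
$G_{k+1}$, here $t\circ g_{k+1}$, becomes in $G_{n+1}$ the join of its restriction to $G_k$
(`Join.inl_comp_homotopic_map`). (2) $t\circ g_k$ is homotopic to $\gamma_{k,n}$, and since $t$ is a
section the homotopy can be made vertical (`VerticallyHomotopic.of_section`), so the joins agree up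
to homotopy. (3) The join of $\gamma_{k,n}$ is $\gamma_{k+1,n+1}$ up to homotopy
(`map_γTo_homotopic`). -/

namespace Ganea

open unitInterval ContinuousMap

/-! ### Concatenation of paths with a variable cut point. -/

section Splice

variable {X Z : Type*} [TopologicalSpace X] [TopologicalSpace Z]

/-- The concatenation of the path `L` with the restriction of `w` to `[s, 1]`, where the two pieces
take times proportional to `1` and `1 - s`; so it is `L` itself if `s = 1`. -/
noncomputable def spliceFun (L w : C(I, X)) (s t : I) : X :=
  if (t : ℝ) * (2 - s) ≤ 1 then L (Set.projIcc 0 1 zero_le_one (t * (2 - s)))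
  else w (Set.projIcc 0 1 zero_le_one (s + t * (2 - s) - 1))

theorem continuous_spliceFun {L w : Z → C(I, X)} {s t : Z → I} (hL : Continuous L)
    (hw : Continuous w) (hs : Continuous s) (ht : Continuous t)
    (h : ∀ z, L z 1 = w z (s z)) : Continuous fun z => spliceFun (L z) (w z) (s z) (t z) := by
  unfold spliceFun
  have hst : Continuous fun z => (t z : ℝ) * (2 - s z) := by fun_prop
  refine Continuous.if_le ?_ ?_ hst continuous_const ?_
  · exact hL.eval (continuous_projIcc.comp hst)
  · exact hw.eval (continuous_projIcc.comp (by fun_prop))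
  · intro z hz
    -- On the seam $t(2-s)=1$ the second branch evaluates `w` at $s$ and the first evaluates `L` at
    -- $1$.
    have e : (s z : ℝ) + t z * (2 - s z) - 1 = s z := by linarith
    rw [e, hz, Set.projIcc_right, Set.projIcc_val]
    exact h z

/-- `spliceFun` as a path. -/
noncomputable def splice (L w : C(I, X)) (s : I) (h : L 1 = w s) : C(I, X) where
  toFun := spliceFun L w s
  continuous_toFun := continuous_spliceFun continuous_const continuous_const continuous_const
    continuous_id fun _ => h

theorem continuous_splice {L w : Z → C(I, X)} {s : Z → I} (hL : Continuous L)
    (hw : Continuous w) (hs : Continuous s) (h : ∀ z, L z 1 = w z (s z)) :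
    Continuous fun z => splice (L z) (w z) (s z) (h z) := by
  refine continuous_of_continuous_uncurry _ ?_
  exact continuous_spliceFun (hL.comp continuous_fst) (hw.comp continuous_fst)
    (hs.comp continuous_fst) continuous_snd fun q => h q.1

theorem splice_congr {L L' w : C(I, X)} {s : I} (e : L = L') (h : L 1 = w s) (h' : L' 1 = w s) :
    splice L w s h = splice L' w s h' := by
  subst e
  rfl

theorem splice_zero (L w : C(I, X)) (s : I) (h : L 1 = w s) : splice L w s h 0 = L 0 := by
  simp [splice, spliceFun]

theorem splice_one (L w : C(I, X)) (s : I) (h : L 1 = w s) : splice L w s h 1 = w 1 := by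
  simp only [splice, coe_mk, spliceFun, Set.Icc.coe_one, one_mul]
  split_ifs with hs
  -- At $t=1$ the first branch is active only if $2-s\le 1$.
  · have : s = 1 := le_antisymm le_one' (Subtype.coe_le_coe.1 (by push_cast; linarith))
    subst this
    norm_num [h]
  · have e : (s : ℝ) + (2 - s) - 1 = 1 := by ring
    rw [e, Set.projIcc_right]
    rfl

/-- The proportional timing is chosen for this strict equality: deformations that move the cut to
$s=1$ end exactly at the given path, with no reparametrization left over. -/
theorem splice_at_one (L w : C(I, X)) (h : L 1 = w 1) : splice L w 1 h = L := by
  ext t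
  have ht : (t : ℝ) * (2 - (1 : I)) = t := by norm_num
  simp only [splice, coe_mk, spliceFun, ht]
  rw [if_pos t.2.2, Set.projIcc_val]

/-- The path `w` slowed down by the factor `s`: it runs along the restriction of `w` to
`[0, s]`. -/
def initial (w : C(I, X)) (s : I) : C(I, X) := w.comp ⟨fun t => s * t, by fun_prop⟩

theorem continuous_initial {w : Z → C(I, X)} {s : Z → I} (hw : Continuous w) (hs : Continuous s) :
    Continuous fun z => initial (w z) (s z) := by
  refine continuous_of_continuous_uncurry _ ?_
  exact (hw.comp continuous_fst).eval ((hs.comp continuous_fst).mul continuous_snd)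

end Splice

/-! ### Maps into homotopy pullbacks and homotopies out of homotopy pushouts. -/

section Squares

variable {A E F X Y Z : Type u} [TopologicalSpace A] [TopologicalSpace E] [TopologicalSpace F]
  [TopologicalSpace X] [TopologicalSpace Y] [TopologicalSpace Z]

/-- The path component of a point of the homotopy pullback. -/
def HPullback.path (f : C(E, X)) (g : C(A, X)) : C(HPullback f g, C(I, X)) where
  toFun p := p.1.2.1
  continuous_toFun := (continuous_fst.comp continuous_snd).comp continuous_subtype_val

theorem HPullback.path_zero (f : C(E, X)) (g : C(A, X)) (p : HPullback f g) :
    path f g p 0 = f (fst f g p) := p.2.1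

theorem HPullback.path_one (f : C(E, X)) (g : C(A, X)) (p : HPullback f g) :
    path f g p 1 = g (snd f g p) := p.2.2

@[ext]
theorem HPullback.ext {f : C(E, X)} {g : C(A, X)} {p q : HPullback f g}
    (h₁ : fst f g p = fst f g q) (h₂ : path f g p = path f g q) (h₃ : snd f g p = snd f g q) :
    p = q :=
  Subtype.ext (Prod.ext h₁ (Prod.ext h₂ h₃))

/-- The map to the homotopy pullback with given components. -/
def HPullback.lift (f : C(E, X)) (g : C(A, X)) {e : Z → E} {w : Z → C(I, X)} {a : Z → A}
    (he : Continuous e) (hw : Continuous w) (ha : Continuous a)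
    (h₀ : ∀ z, w z 0 = f (e z)) (h₁ : ∀ z, w z 1 = g (a z)) : C(Z, HPullback f g) where
  toFun z := ⟨(e z, w z, a z), h₀ z, h₁ z⟩
  continuous_toFun := (he.prodMk (hw.prodMk ha)).subtype_mk _

/-- The cylinder in the homotopy pushout. -/
def HPushout.cyl (b : C(F, E)) (h : C(F, A)) : C(F × I, HPushout b h) where
  toFun q := Quot.mk _ (Sum.inr (Sum.inl q))
  continuous_toFun := continuous_quot_mk.comp (continuous_inr.comp continuous_inl)

theorem HPushout.cyl_zero (b : C(F, E)) (h : C(F, A)) (z : F) :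
    cyl b h (z, 0) = inl b h (b z) := Quot.sound (Rel.zero z)

theorem HPushout.cyl_one (b : C(F, E)) (h : C(F, A)) (z : F) :
    cyl b h (z, 1) = inr b h (h z) := Quot.sound (Rel.one z)

theorem HPushout.hom_ext {b : C(F, E)} {h : C(F, A)} {φ ψ : C(HPushout b h, Y)}
    (hE : ∀ e, φ (inl b h e) = ψ (inl b h e)) (hF : ∀ q, φ (cyl b h q) = ψ (cyl b h q))
    (hA : ∀ a, φ (inr b h a) = ψ (inr b h a)) : φ = ψ := by
  ext p
  obtain ⟨e | q | a, rfl⟩ := Quot.exists_rep p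
  exacts [hE e, hF q, hA a]

/-- Homotopies on the two ends and on the cylinder which fit together define a homotopy of maps
out of the homotopy pushout. -/
theorem HPushout.homotopic {b : C(F, E)} {h : C(F, A)} {φ ψ : C(HPushout b h, Y)}
    (HE : C(E × I, Y)) (HF : C((F × I) × I, Y)) (HA : C(A × I, Y))
    (h₀ : ∀ z v, HF ((z, 0), v) = HE (b z, v)) (h₁ : ∀ z v, HF ((z, 1), v) = HA (h z, v))
    (hE₀ : ∀ e, HE (e, 0) = φ (inl b h e)) (hE₁ : ∀ e, HE (e, 1) = ψ (inl b h e))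
    (hF₀ : ∀ q, HF (q, 0) = φ (cyl b h q)) (hF₁ : ∀ q, HF (q, 1) = ψ (cyl b h q))
    (hA₀ : ∀ a, HA (a, 0) = φ (inr b h a)) (hA₁ : ∀ a, HA (a, 1) = ψ (inr b h a)) :
    φ.Homotopic ψ := by
  -- Currying the homotopy into the path space of `Y` reduces continuity to the quotient topology on
  -- the pushout, with no product of a quotient with $I$.
  let H : C(HPushout b h, C(I, Y)) := whisker b h HE.curry HA.curry
    { toFun := fun q => HF.curry (q.2, q.1)
      continuous_toFun := HF.curry.continuous.comp (continuous_snd.prodMk continuous_fst)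
      map_zero_left := fun z => by ext v; exact h₀ z v
      map_one_left := fun z => by ext v; exact h₁ z v }
  have H₀ : (⟨fun p => H p 0, H.continuous.eval continuous_const⟩ : C(HPushout b h, Y)) = φ :=
    hom_ext hE₀ hF₀ hA₀
  have H₁ : (⟨fun p => H p 1, H.continuous.eval continuous_const⟩ : C(HPushout b h, Y)) = ψ :=
    hom_ext hE₁ hF₁ hA₁
  exact ⟨{
    toFun := fun q => H q.2 q.1
    continuous_toFun := (H.continuous.comp continuous_snd).eval continuous_fst
    map_zero_left := fun p => DFunLike.congr_fun H₀ p
    map_one_left := fun p => DFunLike.congr_fun H₁ p }⟩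

end Squares

/-! ### The path fibration and vertical homotopies. -/

section Fibration

variable {D E X Z : Type u} [TopologicalSpace D] [TopologicalSpace E] [TopologicalSpace X]
  [TopologicalSpace Z]

/-- The path fibration that replaces `f`; its projection to `X` is `HPullback.snd`. -/
abbrev PathFib (f : C(D, X)) : Type u := HPullback f (ContinuousMap.id X)

namespace PathFib

variable (f : C(D, X))

/-- The end point of an element of the path fibration. -/
abbrev proj : C(PathFib f, X) := HPullback.snd f (ContinuousMap.id X)

/-- The point of `D` underlying an element of the path fibration. -/
abbrev pt : C(PathFib f, D) := HPullback.fst f (ContinuousMap.id X)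

/-- The path of an element of the path fibration. -/
abbrev path : C(PathFib f, C(I, X)) := HPullback.path f (ContinuousMap.id X)

/-- The inclusion of `D` in the path fibration by constant paths. -/
def incl : C(D, PathFib f) :=
  HPullback.lift f (ContinuousMap.id X) (e := fun d => d) (w := fun d => ContinuousMap.const I (f d))
    (a := f) continuous_id (continuous_of_continuous_uncurry _ (f.continuous.comp continuous_fst))
    f.continuous (fun _ => rfl) (fun _ => rfl)

/-- The path fibration deforms to `D`. -/
theorem incl_comp_pt_homotopic :
    ((incl f).comp (pt f)).Homotopic (ContinuousMap.id (PathFib f)) := by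
  have hp : Continuous fun q : I × PathFib f => path f q.2 :=
    (path f).continuous.comp continuous_snd
  refine ⟨{
    toContinuousMap := HPullback.lift f (ContinuousMap.id X)
      (e := fun q : I × PathFib f => pt f q.2) (w := fun q => initial (path f q.2) q.1)
      (a := fun q => path f q.2 q.1) ((pt f).continuous.comp continuous_snd)
      (continuous_initial hp continuous_fst) (hp.eval continuous_fst) ?_ ?_
    map_zero_left := ?_
    map_one_left := ?_ }⟩
  · intro q
    simpa [initial] using HPullback.path_zero _ _ q.2
  · intro q
    simp [initial]
  · intro x
    refine HPullback.ext rfl ?_ (HPullback.path_zero _ _ x)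
    ext t
    exact (congrArg (path f x) (zero_mul t)).trans (HPullback.path_zero _ _ x)
  · intro x
    refine HPullback.ext rfl ?_ (HPullback.path_one _ _ x)
    ext t
    exact congrArg (path f x) (one_mul t)

variable {f}

/-- Homotopy of maps to the path fibration over a fixed map to `X`. -/
def VerticallyHomotopic (r : C(Z, X)) (x y : C(Z, PathFib f)) : Prop :=
  HomotopicWith x y fun u => (proj f).comp u = r

/-- A homotopy from `x` to `y` in the path fibration is, up to vertical homotopy, the transport of
`x` along the underlying homotopy in `X`. -/
theorem verticallyHomotopic_transport {x y : C(Z, PathFib f)} (K : x.Homotopy y)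
    (R : C(Z, C(I, X))) (h : ∀ v z, proj f (K (v, z)) = R z v) (hx : ∀ z, path f (x z) 1 = R z 0)
    {r : C(Z, X)} (hr : ∀ z, R z 1 = r z) :
    VerticallyHomotopic r
      (HPullback.lift f (ContinuousMap.id X) (e := fun z => pt f (x z))
        (w := fun z => splice (path f (x z)) (R z) 0 (hx z)) (a := r)
        ((pt f).comp x).continuous
        (continuous_splice ((path f).comp x).continuous R.continuous continuous_const hx)
        r.continuous
        (fun _ => (splice_zero _ _ _ _).trans (HPullback.path_zero _ _ _))
        (fun z => (splice_one _ _ _ _).trans (hr z))) y := by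
  have hK : ∀ q : I × Z, path f (K q) 1 = R q.2 q.1 := fun q =>
    (HPullback.path_one _ _ _).trans (h q.1 q.2)
  -- At time $v$, the path of $K(v,z)$ is continued along $R_z$ from $v$ to $1$, so the end point
  -- stays at $r(z)$ throughout.
  refine ⟨{
    toContinuousMap := HPullback.lift f (ContinuousMap.id X) (e := fun q : I × Z => pt f (K q))
      (w := fun q => splice (path f (K q)) (R q.2) q.1 (hK q)) (a := fun q => r q.2)
      ((pt f).continuous.comp K.continuous)
      (continuous_splice ((path f).continuous.comp K.continuous) (R.continuous.comp continuous_snd)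
        continuous_fst hK)
      (r.continuous.comp continuous_snd)
      (fun q => (splice_zero _ _ _ _).trans (HPullback.path_zero _ _ _))
      (fun q => (splice_one _ _ _ _).trans (hr q.2))
    map_zero_left := ?_
    map_one_left := ?_
    prop' := fun t => rfl }⟩
  · intro z
    refine HPullback.ext ?_ ?_ rfl
    · exact (congrArg (pt f) (K.apply_zero z) :)
    · exact splice_congr (congrArg (path f) (K.apply_zero z) :) (hK (0, z)) (hx z)
  · intro z
    refine HPullback.ext ?_ ?_ ?_
    · exact (congrArg (pt f) (K.apply_one z) :)
    · exact (splice_at_one _ _ (hK (1, z))).trans (congrArg (path f) (K.apply_one z))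
    · exact (hr z).symm.trans ((h 1 z).symm.trans (congrArg (proj f) (K.apply_one z)))

/-- Two homotopies in the path fibration with the same start and the same image in `X` have
vertically homotopic ends. -/
theorem VerticallyHomotopic.of_homotopy {x y z : C(Z, PathFib f)} (K : x.Homotopy y)
    (L : x.Homotopy z) (h : ∀ q, proj f (K q) = proj f (L q)) {r : C(Z, X)}
    (hr : (proj f).comp y = r) : VerticallyHomotopic r y z := by
  let R : C(Z, C(I, X)) :=
    ⟨fun z => ⟨fun v => proj f (K (v, z)), by fun_prop⟩,
      continuous_of_continuous_uncurry _ ((proj f).continuous.comp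
        (K.continuous.comp (continuous_snd.prodMk continuous_fst)))⟩
  have hx : ∀ z, path f (x z) 1 = R z 0 := fun z =>
    (HPullback.path_one _ _ _).trans (congrArg (proj f) (K.apply_zero z).symm)
  have hR : ∀ z, R z 1 = r z := fun z =>
    (congrArg (proj f) (K.apply_one z)).trans (DFunLike.congr_fun hr z)
  -- Both ends are compared with the transport of `x` along the common image `R`.
  exact (verticallyHomotopic_transport K R (fun _ _ => rfl) hx hR).symm.trans
    (verticallyHomotopic_transport L R (fun v p => (h (v, p)).symm) hx hR)

/-- If `s` is a section of the path fibration, then a map `x` to the path fibration over `r` that is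
homotopic to `s ∘ r` is vertically homotopic to it. -/
theorem VerticallyHomotopic.of_section {s : C(X, PathFib f)}
    (hs : (proj f).comp s = ContinuousMap.id X) {r : C(Z, X)} {x : C(Z, PathFib f)}
    (hx : (proj f).comp x = r) (h : (s.comp r).Homotopic x) :
    VerticallyHomotopic r (s.comp r) x := by
  obtain ⟨K⟩ := h
  have hs' : ∀ p, proj f (s p) = p := DFunLike.congr_fun hs
  -- $L=s\circ\mathrm{proj}\circ K$ has the same image in $X$ as `K` and the same start, but returns
  -- to $s\circ r$.
  let L : (s.comp r).Homotopy (s.comp r) :=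
    ((ContinuousMap.Homotopy.refl (s.comp (proj f))).comp K).cast
      (by ext1 z; exact congrArg s (hs' (r z)))
      (by ext1 z; exact congrArg s (DFunLike.congr_fun hx z))
  refine VerticallyHomotopic.of_homotopy L K (fun q => hs' _) ?_
  ext z
  exact hs' (r z)

/-- A homotopy section of `f` defines a section of the path fibration. -/
theorem exists_section {e : C(X, D)} (h : (f.comp e).Homotopic (ContinuousMap.id X)) :
    ∃ s : C(X, PathFib f), (proj f).comp s = ContinuousMap.id X ∧ (pt f).comp s = e := by
  obtain ⟨L⟩ := h
  refine ⟨HPullback.lift f (ContinuousMap.id X) (e := e)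
    (w := fun x => ⟨fun t => L (t, x), by fun_prop⟩) (a := fun x => x) e.continuous
    (continuous_of_continuous_uncurry _
      (L.continuous.comp (continuous_snd.prodMk continuous_fst)))
    continuous_id (fun x => by simp) (fun x => by simp), rfl, rfl⟩

/-- Deforming the fibration onto `D` turns the homotopy `h` into one in the fibration, in general
not vertical; `VerticallyHomotopic.of_section` then corrects it. -/
theorem verticallyHomotopic_of_compatible {s : C(X, PathFib f)}
    (hs : (proj f).comp s = ContinuousMap.id X) {r : C(E, X)} {d : C(E, D)} (hd : f.comp d = r)
    (h : (((pt f).comp s).comp r).Homotopic d) :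
    VerticallyHomotopic r (s.comp r) ((incl f).comp d) := by
  refine VerticallyHomotopic.of_section hs hd ?_
  exact (((incl_comp_pt_homotopic f).comp (Homotopic.refl (s.comp r))).symm).trans
    ((Homotopic.refl (incl f)).comp h)

end PathFib

end Fibration

/-! ### Functoriality of the join with `ι`. -/

section Join

variable {A D E X : Type u} [TopologicalSpace A] [TopologicalSpace D] [TopologicalSpace E]
  [TopologicalSpace X]

/-- The carrier of `SpaceOver.join`. -/
abbrev Join (f : C(D, X)) (ι : C(A, X)) : Type u :=
  HPushout (HPullback.fst f ι) (HPullback.snd f ι)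

namespace Join

variable (f : C(D, X)) (ι : C(A, X))

/-- The inclusion of the first factor of the join. -/
abbrev inl : C(D, Join f ι) := HPushout.inl _ _

/-- The inclusion of the second factor of the join. -/
abbrev inr : C(A, Join f ι) := HPushout.inr _ _

/-- The cylinder in the join. -/
abbrev cyl : C(HPullback f ι × I, Join f ι) := HPushout.cyl _ _

/-- The map from the join to `X`. -/
abbrev toBase : C(Join f ι, X) := HPushout.whisker _ _ f ι (HPullback.homotopy f ι)

variable {f ι} {r : C(E, X)}

open PathFib

theorem path_one_eq {x : C(E, PathFib f)} (hx : (proj f).comp x = r) (z : HPullback r ι) :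
    path f (x (HPullback.fst r ι z)) 1 = HPullback.path r ι z 0 :=
  (HPullback.path_one _ _ _).trans
    ((DFunLike.congr_fun hx _).trans (HPullback.path_zero r ι z).symm)

/-- A map over `X` to the path fibration of `f` induces a map of homotopy pullbacks. -/
noncomputable def pullbackMap (x : C(E, PathFib f)) (hx : (proj f).comp x = r) :
    C(HPullback r ι, HPullback f ι) :=
  HPullback.lift f ι (e := fun z => pt f (x (HPullback.fst r ι z)))
    (w := fun z => splice (path f (x (HPullback.fst r ι z))) (HPullback.path r ι z) 0
      (path_one_eq hx z))
    (a := HPullback.snd r ι) (by fun_prop)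
    (continuous_splice (by fun_prop) (by fun_prop) continuous_const (path_one_eq hx))
    (by fun_prop)
    (fun z => (splice_zero _ _ _ _).trans (HPullback.path_zero _ _ _))
    (fun z => (splice_one _ _ _ _).trans (HPullback.path_one _ _ _))

/-- A map over `X` to the path fibration of `f` induces a map of joins. -/
noncomputable def map (x : C(E, PathFib f)) (hx : (proj f).comp x = r) :
    C(Join r ι, Join f ι) :=
  HPushout.whisker _ _ ((inl f ι).comp ((pt f).comp x)) (inr f ι)
    { toFun := fun q => cyl f ι (pullbackMap x hx q.2, q.1)
      continuous_toFun := by fun_prop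
      map_zero_left := fun _ => HPushout.cyl_zero _ _ _
      map_one_left := fun _ => HPushout.cyl_one _ _ _ }

theorem map_congr {x y : C(E, PathFib f)} (e : x = y) (hx : (proj f).comp x = r)
    (hy : (proj f).comp y = r) : map (ι := ι) x hx = map y hy := by
  subst e
  rfl

/-- Vertically homotopic maps to the path fibration induce homotopic maps of joins. -/
theorem map_homotopic {x y : C(E, PathFib f)} (h : VerticallyHomotopic r x y)
    (hx : (proj f).comp x = r) (hy : (proj f).comp y = r) :
    (map (ι := ι) x hx).Homotopic (map y hy) := by
  obtain ⟨K⟩ := h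
  have hr : ∀ q, proj f (K q) = r q.2 := fun q => DFunLike.congr_fun (K.prop q.1) q.2
  have hK : ∀ q : HPullback r ι × I,
      path f (K (q.2, HPullback.fst r ι q.1)) 1 = HPullback.path r ι q.1 0 :=
    fun q => (HPullback.path_one _ _ _).trans
      ((hr _).trans (HPullback.path_zero r ι q.1).symm)
  have hKc : Continuous fun q : HPullback r ι × I => K (q.2, HPullback.fst r ι q.1) :=
    K.continuous.comp (by fun_prop)
  let P : C(HPullback r ι × I, HPullback f ι) :=
    HPullback.lift f ι (e := fun q => pt f (K (q.2, HPullback.fst r ι q.1)))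
      (w := fun q => splice (path f (K (q.2, HPullback.fst r ι q.1))) (HPullback.path r ι q.1) 0
        (hK q))
      (a := fun q => HPullback.snd r ι q.1) ((pt f).continuous.comp hKc)
      (continuous_splice ((path f).continuous.comp hKc) (by fun_prop) continuous_const hK)
      (by fun_prop)
      (fun z => (splice_zero _ _ _ _).trans (HPullback.path_zero _ _ _))
      (fun z => (splice_one _ _ _ _).trans (HPullback.path_one _ _ _))
  have key : ∀ (z : HPullback r ι) (v : I) (u : C(E, PathFib f)) (hu : (proj f).comp u = r),
      (∀ e, K (v, e) = u e) → P (z, v) = pullbackMap u hu z := by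
    intro z v u hu h
    refine HPullback.ext ?_ ?_ rfl
    · exact (congrArg (pt f) (h _) :)
    · exact splice_congr (congrArg (path f) (h (HPullback.fst r ι z)) :)
        (hK (z, v)) (path_one_eq hu z)
  refine HPushout.homotopic
    ⟨fun q => inl f ι (pt f (K (q.2, q.1))),
      (inl f ι).continuous.comp ((pt f).continuous.comp
        (K.continuous.comp (continuous_snd.prodMk continuous_fst)))⟩
    ⟨fun q => cyl f ι (P (q.1.1, q.2), q.1.2), by fun_prop⟩
    ⟨fun q => inr f ι q.1, by fun_prop⟩
    (fun _ _ => HPushout.cyl_zero _ _ _) (fun _ _ => HPushout.cyl_one _ _ _)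
    (fun e => ?_) (fun e => ?_) (fun q => ?_) (fun q => ?_) (fun _ => rfl) (fun _ => rfl)
  · exact (congrArg (fun p => inl f ι (pt f p)) (K.apply_zero e) :)
  · exact (congrArg (fun p => inl f ι (pt f p)) (K.apply_one e) :)
  · exact (congrArg (fun p => cyl f ι (p, q.2)) (key q.1 0 x hx K.apply_zero) :)
  · exact (congrArg (fun p => cyl f ι (p, q.2)) (key q.1 1 y hy K.apply_one) :)

/-- The inclusion of constant paths induces a map of joins that is homotopic to the identity. -/
theorem map_incl_homotopic :
    (map (ι := ι) (incl f) (r := f) rfl).Homotopic (ContinuousMap.id (Join f ι)) := by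
  have h : ∀ q : HPullback f ι × I,
      initial (HPullback.path f ι q.1) q.2 1 = HPullback.path f ι q.1 q.2 := fun q =>
    congrArg (HPullback.path f ι q.1) (mul_one q.2)
  have hp : Continuous fun q : HPullback f ι × I => HPullback.path f ι q.1 := by fun_prop
  -- The path is cut at $v$ and reassembled: $v=0$ puts a constant path in front, $v=1$ gives the
  -- path back.
  let P : C(HPullback f ι × I, HPullback f ι) :=
    HPullback.lift f ι (e := fun q => HPullback.fst f ι q.1)
      (w := fun q => splice (initial (HPullback.path f ι q.1) q.2) (HPullback.path f ι q.1) q.2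
        (h q))
      (a := fun q => HPullback.snd f ι q.1) (by fun_prop)
      (continuous_splice (continuous_initial hp continuous_snd) hp continuous_snd h)
      (by fun_prop)
      (fun q => (splice_zero _ _ _ _).trans
        ((congrArg (HPullback.path f ι q.1) (mul_zero q.2)).trans (HPullback.path_zero _ _ _)))
      (fun q => (splice_one _ _ _ _).trans (HPullback.path_one _ _ _))
  have key₀ : ∀ z, P (z, 0) = pullbackMap (incl f) rfl z := by
    intro z
    refine HPullback.ext rfl (splice_congr ?_ (h (z, 0)) (path_one_eq (r := f) rfl z)) rfl
    ext t
    exact (congrArg (HPullback.path f ι z) (zero_mul t)).trans (HPullback.path_zero _ _ _)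
  have key₁ : ∀ z, P (z, 1) = z := by
    intro z
    refine HPullback.ext rfl ?_ rfl
    refine (splice_at_one _ _ (h (z, 1))).trans ?_
    ext t
    exact congrArg (HPullback.path f ι z) (one_mul t)
  refine HPushout.homotopic
    ⟨fun q => inl f ι q.1, by fun_prop⟩
    ⟨fun q => cyl f ι (P (q.1.1, q.2), q.1.2), by fun_prop⟩
    ⟨fun q => inr f ι q.1, by fun_prop⟩
    (fun _ _ => HPushout.cyl_zero _ _ _) (fun _ _ => HPushout.cyl_one _ _ _)
    (fun _ => rfl) (fun _ => rfl) (fun q => ?_) (fun q => ?_) (fun _ => rfl) (fun _ => rfl)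
  · exact (congrArg (fun p => cyl f ι (p, q.2)) (key₀ q.1) :)
  · exact (congrArg (fun p => cyl f ι (p, q.2)) (key₁ q.1) :)

/-- A map over `X` from the join of `r` and `ι` to the path fibration of `f` becomes homotopic, in
the join of `f` and `ι`, to the map of joins induced by its restriction to the first factor. -/
theorem inl_comp_homotopic_map (u : C(Join r ι, PathFib f)) (hu : (proj f).comp u = toBase r ι)
    (hx : (proj f).comp (u.comp (inl r ι)) = r) :
    ((inl f ι).comp ((pt f).comp u)).Homotopic (map (ι := ι) (u.comp (inl r ι)) hx) := by
  have h : ∀ q : HPullback r ι × I, path f (u (cyl r ι q)) 1 = HPullback.path r ι q.1 q.2 :=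
    fun q => (HPullback.path_one _ _ _).trans (DFunLike.congr_fun hu (cyl r ι q))
  -- The path carried by $u$ at the cylinder point $(z,t)$ ends at $\omega(t)$; continuing along
  -- $\omega$ to its end reaches the image of `ι`.
  let P : C(HPullback r ι × I, HPullback f ι) :=
    HPullback.lift f ι (e := fun q => pt f (u (cyl r ι q)))
      (w := fun q => splice (path f (u (cyl r ι q))) (HPullback.path r ι q.1) q.2 (h q))
      (a := fun q => HPullback.snd r ι q.1) (by fun_prop)
      (continuous_splice (by fun_prop) (by fun_prop) continuous_snd h) (by fun_prop)
      (fun z => (splice_zero _ _ _ _).trans (HPullback.path_zero _ _ _))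
      (fun z => (splice_one _ _ _ _).trans (HPullback.path_one _ _ _))
  have hA : ∀ a, path f (u (inr r ι a)) 1 = ι a := fun a =>
    (HPullback.path_one _ _ _).trans (DFunLike.congr_fun hu (inr r ι a))
  let Q : C(A, HPullback f ι) :=
    HPullback.lift f ι (e := fun a => pt f (u (inr r ι a)))
      (w := fun a => path f (u (inr r ι a))) (a := fun a => a) (by fun_prop) (by fun_prop)
      (by fun_prop) (fun a => HPullback.path_zero _ _ _) hA
  have hP₁ : ∀ z, P (z, 1) = Q (HPullback.snd r ι z) := by
    intro z
    have e : u (cyl r ι (z, 1)) = u (inr r ι (HPullback.snd r ι z)) :=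
      congrArg u (HPushout.cyl_one _ _ z)
    refine HPullback.ext ?_ ?_ rfl
    · exact (congrArg (pt f) e :)
    · exact (splice_at_one _ _ (h (z, 1))).trans (congrArg (path f) e :)
  have hP₀ : ∀ z, P (z, 0) = pullbackMap (u.comp (inl r ι)) hx z := by
    intro z
    have e : u (cyl r ι (z, 0)) = u (inl r ι (HPullback.fst r ι z)) :=
      congrArg u (HPushout.cyl_zero _ _ z)
    refine HPullback.ext ?_ ?_ rfl
    · exact (congrArg (pt f) e :)
    · exact splice_congr (congrArg (path f) e :) (h (z, 0)) (path_one_eq hx z)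
  have hE : ∀ z, inl f ι (pt f (u (cyl r ι (z, 0)))) =
      inl f ι (pt f (u (inl r ι (HPullback.fst r ι z)))) := fun z =>
    congrArg (fun p => inl f ι (pt f (u p))) (HPushout.cyl_zero _ _ z)
  -- Intermediate map: $(z,t)$ goes to height $t$ over $P(z,t)$.
  let ψ : C(Join r ι, Join f ι) :=
    HPushout.whisker _ _ ((inl f ι).comp ((pt f).comp (u.comp (inl r ι)))) (inr f ι)
      { toFun := fun q => cyl f ι (P (q.2, q.1), q.1)
        continuous_toFun := by fun_prop
        map_zero_left := fun z => (HPushout.cyl_zero _ _ _).trans (hE z)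
        map_one_left := fun _ => HPushout.cyl_one _ _ _ }
  -- Only the height moves, from $0$ to $t$ via $vt$; on `A` this pushes the first end to the second
  -- along the cylinder over `Q`.
  have h₁ : ((inl f ι).comp ((pt f).comp u)).Homotopic ψ := by
    refine HPushout.homotopic
      ⟨fun q => inl f ι (pt f (u (inl r ι q.1))), by fun_prop⟩
      ⟨fun q => cyl f ι (P q.1, q.2 * q.1.2), by fun_prop⟩
      ⟨fun q => cyl f ι (Q q.1, q.2), by fun_prop⟩ ?_ ?_
      (fun _ => rfl) (fun _ => rfl) (fun q => ?_) (fun q => ?_)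
      (fun a => HPushout.cyl_zero _ _ _) (fun a => HPushout.cyl_one _ _ _)
    · intro z v
      refine (congrArg (fun t => cyl f ι (P (z, 0), t)) (mul_zero v)).trans ?_
      exact (HPushout.cyl_zero _ _ _).trans (hE z)
    · intro z v
      change cyl f ι (P (z, 1), v * 1) = cyl f ι (Q _, v)
      rw [mul_one, hP₁]
    · refine (congrArg (fun t => cyl f ι (P q, t)) (zero_mul q.2)).trans ?_
      exact HPushout.cyl_zero _ _ _
    · exact (congrArg (fun t => cyl f ι (P q, t)) (one_mul q.2) :)
  -- Here the height stays $t$ and the pullback point moves from $P(z,0)$ to $P(z,t)$.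
  have h₂ : (map (ι := ι) (u.comp (inl r ι)) hx).Homotopic ψ := by
    refine HPushout.homotopic
      ⟨fun q => inl f ι (pt f (u (inl r ι q.1))), by fun_prop⟩
      ⟨fun q => cyl f ι (P (q.1.1, q.2 * q.1.2), q.1.2), by fun_prop⟩
      ⟨fun q => inr f ι q.1, by fun_prop⟩ ?_ (fun _ _ => HPushout.cyl_one _ _ _)
      (fun _ => rfl) (fun _ => rfl) (fun q => ?_) (fun q => ?_)
      (fun _ => rfl) (fun _ => rfl)
    · intro z v
      refine (congrArg (fun t => cyl f ι (P (z, t), 0)) (mul_zero v)).trans ?_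
      exact (HPushout.cyl_zero _ _ _).trans (hE z)
    · refine (congrArg (fun t => cyl f ι (P (q.1, t), q.2)) (zero_mul q.2)).trans ?_
      exact (congrArg (fun p => cyl f ι (p, q.2)) (hP₀ q.1) :)
    · exact (congrArg (fun t => cyl f ι (P (q.1, t), q.2)) (one_mul q.2) :)
  exact h₁.trans h₂.symm

end Join

end Join

/-! ### Compatibility of sections and the inequalities for `relcat`. -/

section Main

variable {A X : Type u} [TopologicalSpace A] [TopologicalSpace X] (ι : C(A, X))

open PathFib

theorem γTo_self (k : ℕ) : γTo ι k le_rfl = ContinuousMap.id (G ι k) :=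
  Nat.leRec_self _ _

theorem γTo_succ {k n : ℕ} (hkn : k ≤ n) :
    γTo ι k (Nat.le_succ_of_le hkn) = (γ ι n).comp (γTo ι k hkn) :=
  Nat.leRec_succ _ _ hkn

theorem g_comp_γ (i : ℕ) : (g ι (i + 1)).comp (γ ι i) = g ι i := rfl

theorem g_comp_γTo {k n : ℕ} (hkn : k ≤ n) : (g ι n).comp (γTo ι k hkn) = g ι k := by
  induction n, hkn using Nat.le_induction with
  | base => rw [γTo_self]; rfl
  | succ n hkn ih => rw [γTo_succ ι hkn, ← ContinuousMap.comp_assoc, g_comp_γ, ih]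

theorem γTo_comp_γ {k n : ℕ} (hkn : k + 1 ≤ n) :
    (γTo ι (k + 1) hkn).comp (γ ι k) = γTo ι k ((Nat.le_succ k).trans hkn) := by
  induction n, hkn using Nat.le_induction with
  | base => rw [γTo_succ ι le_rfl, γTo_self, γTo_self]; rfl
  | succ n hkn ih => rw [γTo_succ ι hkn, γTo_succ ι ((Nat.le_succ k).trans hkn), ← ih]; rfl

/-- The map of joins induced by `γ_{k,n}` is homotopic to `γ_{k+1,n+1}`. -/
theorem map_γTo_homotopic {k n : ℕ} (hkn : k ≤ n)
    (h : (proj (g ι n)).comp ((incl (g ι n)).comp (γTo ι k hkn)) = g ι k) :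
    (Join.map (ι := ι) _ h).Homotopic (γTo ι (k + 1) (Nat.succ_le_succ hkn)) := by
  -- For $k<n$ the map $\gamma_{k,n}$ extends over $G_{k+1}$ as $\gamma_{k+1,n}$, so fact (1)
  -- applies again; for $k=n$ the constant-path inclusion is treated directly.
  obtain rfl | hlt := hkn.eq_or_lt
  · have e : (incl (g ι k)).comp (γTo ι k hkn) = incl (g ι k) := by
      rw [γTo_self, ContinuousMap.comp_id]
    have e' : γTo ι (k + 1) (Nat.succ_le_succ hkn) = ContinuousMap.id _ := γTo_self ι (k + 1)
    rw [e']
    exact (Join.map_congr (ι := ι) e h rfl) ▸ Join.map_incl_homotopic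
  · have e : ((incl (g ι n)).comp (γTo ι (k + 1) hlt)).comp (γ ι k) =
        (incl (g ι n)).comp (γTo ι k hkn) := by
      rw [ContinuousMap.comp_assoc, γTo_comp_γ]
    have h' : (proj (g ι n)).comp (((incl (g ι n)).comp (γTo ι (k + 1) hlt)).comp (γ ι k)) =
        g ι k := by
      rw [e, h]
    have hh := Join.inl_comp_homotopic_map (f := g ι n) (r := g ι k) (ι := ι)
      ((incl (g ι n)).comp (γTo ι (k + 1) hlt)) (g_comp_γTo ι hlt) h'
    have e' : γTo ι (k + 1) (Nat.succ_le_succ hkn) = (γ ι n).comp (γTo ι (k + 1) hlt) :=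
      γTo_succ ι hlt
    rw [e']
    exact (Join.map_congr (ι := ι) e h' h) ▸ hh.symm

/-- Definitional, because $g_{n+1}\circ\gamma_n=g_n$ holds strictly. -/
theorem isHomotopySection_γ_comp {n : ℕ} {s : C(X, G ι n)} (hs : IsHomotopySection ι n s) :
    IsHomotopySection ι (n + 1) ((γ ι n).comp s) := hs

theorem isCompatible_γ_comp {k n : ℕ} (hkn : k ≤ n) {s : C(X, G ι n)}
    (hs : IsHomotopySection ι n s) (hc : IsCompatible ι hkn s) :
    IsCompatible ι (Nat.succ_le_succ hkn) ((γ ι n).comp s) := by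
  obtain ⟨t, ht, rfl⟩ := exists_section hs
  have ht' : ∀ {Z : Type u} [TopologicalSpace Z] (r : C(Z, X)),
      (proj (g ι n)).comp (t.comp r) = r := fun r => by
    rw [← ContinuousMap.comp_assoc, ht, ContinuousMap.id_comp]
  have hd : (proj (g ι n)).comp ((incl (g ι n)).comp (γTo ι k hkn)) = g ι k := g_comp_γTo ι hkn
  -- Since $g_{k+1}$ restricts to $g_k$, the restriction of $t\circ g_{k+1}$ to $G_k$ is $t\circ
  -- g_k$.
  have h₁ := Join.inl_comp_homotopic_map (f := g ι n) (r := g ι k) (ι := ι)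
    (t.comp (g ι (k + 1))) (ht' _) (ht' _)
  have h₂ := Join.map_homotopic (ι := ι)
    (verticallyHomotopic_of_compatible ht (g_comp_γTo ι hkn) hc) (ht' _) hd
  exact (h₁.trans h₂).trans (map_γTo_homotopic ι hkn hd)

theorem IsCompatible.of_succ {k n : ℕ} (hkn : k + 1 ≤ n) {s : C(X, G ι n)}
    (hc : IsCompatible ι hkn s) : IsCompatible ι ((Nat.le_succ k).trans hkn) s := by
  have := ContinuousMap.Homotopic.comp hc (ContinuousMap.Homotopic.refl (γ ι k))
  rwa [γTo_comp_γ] at this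

theorem relcat_le_relcat_succ (k : ℕ) : relcat k ι ≤ relcat (k + 1) ι := by
  refine sInf_le_sInf ?_
  rintro m ⟨n, rfl, hkn, s, hs, hc⟩
  exact ⟨n, rfl, (Nat.le_succ k).trans hkn, s, hs, hc.of_succ⟩

theorem relcat_succ_le (k : ℕ) : relcat (k + 1) ι ≤ relcat k ι + 1 := by
  rcases Set.eq_empty_or_nonempty {m : ℕ∞ | ∃ n : ℕ, m = n ∧ ∃ (hkn : k ≤ n) (s : C(X, G ι n)),
    IsHomotopySection ι n s ∧ IsCompatible ι hkn s} with h | h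
  · have : relcat k ι = ⊤ := by rw [relcat, h, sInf_empty]
    simp [this]
  -- A nonempty set in `ℕ∞` attains its infimum.
  · obtain ⟨n, hn, hkn, s, hs, hc⟩ := csInf_mem h
    rw [show relcat k ι = n from hn]
    exact sInf_le ⟨n + 1, by push_cast; rfl, Nat.succ_le_succ hkn, (γ ι n).comp s,
      isHomotopySection_γ_comp ι hs, isCompatible_γ_comp ι hkn hs hc⟩

end Main

end Ganea

theorem mainTheorem4 {A X : Type u} [TopologicalSpace A] [TopologicalSpace X]
    (ι : C(A, X)) (k : ℕ) :
    (Ganea.relcat k ι ≤ Ganea.relcat (k + 1) ι ∧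
      Ganea.relcat (k + 1) ι ≤ Ganea.relcat k ι + 1) ∧
    ∀ (n : ℕ) (hkn : k ≤ n) (σ : C(X, Ganea.G ι n)),
      Ganea.IsHomotopySection ι n σ → Ganea.IsCompatible ι hkn σ →
        Ganea.IsHomotopySection ι (n + 1) ((Ganea.γ ι n).comp σ) ∧
        Ganea.IsCompatible ι (Nat.succ_le_succ hkn) ((Ganea.γ ι n).comp σ) := by
  exact ⟨⟨Ganea.relcat_le_relcat_succ ι k, Ganea.relcat_succ_le ι k⟩, fun _ hkn _ hs hc =>
    ⟨Ganea.isHomotopySection_γ_comp ι hs, Ganea.isCompatible_γ_comp ι hkn hs hc⟩⟩
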